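/- Let $\mathbb{F}_q$ be a finite field with $q$ elements, let $n,k$ be nonnegative integers with $2k<n$, and let $V$ be an $n$-dimensional vector space over $\mathbb{F}_q$. Let $\Gamma=S(q,n,k)$ be the graph whose vertices are the subspaces of $V$ of dimension $k$ and $k+1$, two distinct vertices being adjacent if and only if one of them is contained in the other. For $j\ge 0$ let $$\binom{n}{j}_q=\prod_{i=0}^{j-1}\frac{q^n-q^i}{q^j-q^i}$$ be the Gaussian binomial coefficient, and put $\binom{n}{-1}_q=0$. For $0\le j\le k$ let $$\theta_j=q^{\,n-j+1}-q^{\,n-k}+q^{\,j}-q^{\,k+1},\qquad \lambda_j=\frac{1}{q-1}\sqrt{\theta_j}.$$ Then $\theta_j>0$ for $0\le j\le k$, and the $2(k+1)$ numbers $\pm\lambda_j$ $(0\le j\le k)$ are nonzero and pairwise distinct. The set of eigenvalues of the adjacency matrix of $\Gamma$ consists of these numbers together with, if $n\neq 2k+1$, the number $0$. As roots of the characteristic polynomial, each of $\lambda_j$ and $-\lambda_j$ has multiplicity $\binom{n}{j}_q-\binom{n}{j-1}_q$, so that the pair $\pm\lambda_j$ has total multiplicity $2\left(\binom{n}{j}_q-\binom{n}{j-1}_q\right)$,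 and $0$ has multiplicity $\binom{n}{k+1}_q-\binom{n}{k}_q$ (which is $0$, i.e. $0$ is not an eigenvalue, exactly when $n=2k+1$). -/

import Mathlib

/-- The vertices of `S(q,n,k)`: the subspaces of `V` of dimension `k` or `k + 1`. -/
abbrev SubspaceVertex (F V : Type*) [Field F] [AddCommGroup V] [Module F V] (k : ℕ) : Type _ :=
  {W : Submodule F V // Module.finrank F W = k ∨ Module.finrank F W = k + 1}

noncomputable instance subspaceVertexFintype (F V : Type*) [Field F] [Finite F] [AddCommGroup V]
    [Module F V] [FiniteDimensional F V] (k : ℕ) : Fintype (SubspaceVertex F V k) :=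
  haveI : Finite V := Module.finite_of_finite F
  Fintype.ofFinite _

/-- The graph `S(q,n,k)` on the subspaces of `V` of dimension `k` and `k + 1`: two distinct
vertices are adjacent when one of them is a subspace of the other. -/
def subspaceGraph (F V : Type*) [Field F] [AddCommGroup V] [Module F V] (k : ℕ) :
    SimpleGraph (SubspaceVertex F V k) where
  Adj v w := v ≠ w ∧ (v.1 ≤ w.1 ∨ w.1 ≤ v.1)
  symm := ⟨fun _ _ h => ⟨h.1.symm, h.2.symm⟩⟩
  loopless := ⟨fun _ h => h.1 rfl⟩

open Classical in
/-- The set of eigenvalues of a finite graph, that is, of its real adjacency matrix. -/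
noncomputable def graphEigenvalues {α : Type*} [Fintype α] (G : SimpleGraph α) : Set ℝ :=
  spectrum ℝ (G.adjMatrix ℝ)

open Classical in
/-- The multiplicity of `x` as a root of the characteristic polynomial of the adjacency matrix
(it is `0` if `x` is not an eigenvalue). -/
noncomputable def graphEigenvalueMultiplicity {α : Type*} [Fintype α] (G : SimpleGraph α)
    (x : ℝ) : ℕ :=
  (G.adjMatrix ℝ).charpoly.rootMultiplicity x

/-- The Gaussian binomial coefficient
`((q^n - 1) (q^n - q) ⋯ (q^n - q^(j-1))) / ((q^j - 1) (q^j - q) ⋯ (q^j - q^(j-1)))`,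
which is `0` for negative `j`. -/
noncomputable def gaussBinom (q : ℝ) (n : ℕ) : ℤ → ℝ
  | Int.ofNat j => ∏ i ∈ Finset.range j, (q ^ n - q ^ i) / (q ^ j - q ^ i)
  | Int.negSucc _ => 0

/-- The number `(1 / (q - 1)) √(q^(n-j+1) - q^(n-k) + q^j - q^(k+1))`, for `j ≤ k ≤ n`. -/
noncomputable def subspaceGraphEigenvalue (q : ℝ) (n k j : ℕ) : ℝ :=
  1 / (q - 1) * √(q ^ (n - j + 1) - q ^ (n - k) + q ^ j - q ^ (k + 1))

/-! Let N_i be the incidence matrix of i-spaces against (i+1)-spaces. The adjacency matrix has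
off-diagonal blocks N_k and N_kᵀ, so its nonzero eigenvalues are ± the square roots of those of N_k
N_kᵀ, and 0 fills the difference of the block sizes.

Two distinct (i+1)-spaces have a common cover exactly when they have a common hyperplane, and each
is then unique. Hence N_{i+1} N_{i+1}ᵀ - N_iᵀ N_i is scalar, equal to [n-i-1] - [i+1] with [m] = 1 +
q + ... + q^(m-1). Since N_iᵀ N_i and N_i N_iᵀ share their characteristic polynomial up to a power
of X, each level shifts the old roots and adds one new root, whose multiplicity is the growth in the
number of subspaces. The j-th root is born at level j, and its shifts up to level k add up to θ_j /
(q-1)². -/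

open Module

/-! ### Counting subspaces above and below given ones -/

section Counting

variable (F V : Type*) [Field F] [AddCommGroup V] [Module F V]

/-- The subspaces of dimension `i`. -/
abbrev SubspaceOfDim (i : ℕ) : Type _ := {W : Submodule F V // finrank F W = i}

noncomputable instance subspaceOfDimFintype [Finite F] [FiniteDimensional F V] (i : ℕ) :
    Fintype (SubspaceOfDim F V i) :=
  haveI : Finite V := Module.finite_of_finite F
  Fintype.ofFinite _

variable {F V}

theorem card_subspaceOfDim_one [Finite F] {m : ℕ} (h : finrank F V = m) :
    Nat.card (SubspaceOfDim F V 1) = ∑ i ∈ Finset.range m, Nat.card F ^ i := by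
  rw [← Projectivization.card_of_finrank F V h]
  exact (Nat.card_congr (Projectivization.equivSubmodule F V)).symm

/-- Annihilators turn hyperplanes into lines of the dual space. -/
theorem card_subspaceOfDim_pred [Finite F] [FiniteDimensional F V] {m : ℕ}
    (h : finrank F V = m + 1) :
    Nat.card (SubspaceOfDim F V m) = ∑ i ∈ Finset.range (m + 1), Nat.card F ^ i := by
  have h' : finrank F (Dual F V) = m + 1 := by rw [Subspace.dual_finrank_eq, h]
  rw [← card_subspaceOfDim_one h']
  refine Nat.card_congr ((Subspace.orderIsoFiniteDimensional (K := F) (V := V)).toEquiv.subtypeEquiv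
    fun W => ?_)
  have := Subspace.finrank_add_finrank_dualAnnihilator_eq W
  change _ ↔ finrank F W.dualAnnihilator = 1
  omega

theorem card_subspaceOfDim_le [Finite F] [FiniteDimensional F V] {m : ℕ}
    (W : SubspaceOfDim F V (m + 1)) :
    Nat.card {X : SubspaceOfDim F V m // X.1 ≤ W.1} =
      ∑ i ∈ Finset.range (m + 1), Nat.card F ^ i := by
  rw [← card_subspaceOfDim_pred W.2]
  refine Nat.card_congr ?_
  refine (Equiv.subtypeSubtypeEquivSubtypeInter _ (fun X : Submodule F V => X ≤ W.1)).trans ?_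
  refine (Equiv.subtypeEquivRight fun X => and_comm).trans ?_
  refine (Equiv.subtypeSubtypeEquivSubtypeInter (fun X : Submodule F V => X ≤ W.1)
    (fun X => finrank F X = m)).symm.trans ?_
  refine (Equiv.subtypeEquiv (Submodule.mapIic W.1).toEquiv fun X => ?_).symm
  change _ ↔ finrank F (X.map W.1.subtype) = m
  rw [Submodule.finrank_map_subtype_eq]

theorem finrank_comap_mkQ [FiniteDimensional F V] (X : Submodule F V) (W : Submodule F (V ⧸ X)) :
    finrank F (W.comap X.mkQ) = finrank F W + finrank F X := by
  have h := (X.mkQ.domRestrict (W.comap X.mkQ)).finrank_range_add_finrank_ker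
  rw [LinearMap.range_domRestrict, LinearMap.ker_domRestrict,
    Submodule.map_comap_eq_of_surjective X.mkQ_surjective, Submodule.ker_mkQ] at h
  have hX : X ≤ W.comap X.mkQ := Submodule.le_comap_mkQ X W
  rw [← h, (Submodule.comapSubtypeEquivOfLe hX).finrank_eq]

/-- By the correspondence theorem these are the lines of `V ⧸ X`. -/
theorem card_le_subspaceOfDim [Finite F] [FiniteDimensional F V] {m n : ℕ}
    (hn : finrank F V = n) (X : SubspaceOfDim F V m) :
    Nat.card {W : SubspaceOfDim F V (m + 1) // X.1 ≤ W.1} =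
      ∑ i ∈ Finset.range (n - m), Nat.card F ^ i := by
  have hq : finrank F (V ⧸ X.1) = n - m := by
    rw [Submodule.finrank_quotient, hn, X.2]
  rw [← card_subspaceOfDim_one hq]
  refine Nat.card_congr ?_
  refine (Equiv.subtypeSubtypeEquivSubtypeInter _ (fun W : Submodule F V => X.1 ≤ W)).trans ?_
  refine (Equiv.subtypeEquivRight fun W => and_comm).trans ?_
  refine (Equiv.subtypeSubtypeEquivSubtypeInter (fun W : Submodule F V => X.1 ≤ W)
    (fun W => finrank F W = m + 1)).symm.trans ?_
  refine (Equiv.subtypeEquiv (Submodule.comapMkQRelIso X.1).toEquiv fun W => ?_).symm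
  change _ ↔ finrank F (W.comap X.1.mkQ) = m + 1
  rw [finrank_comap_mkQ, X.2]
  omega

theorem finrank_sup_eq_add_two_iff [FiniteDimensional F V] {m : ℕ} (X Y : SubspaceOfDim F V (m + 1)) :
    finrank F (X.1 ⊔ Y.1 : Submodule F V) = m + 2 ↔
      finrank F (X.1 ⊓ Y.1 : Submodule F V) = m := by
  have := Submodule.finrank_sup_add_finrank_inf_eq X.1 Y.1
  rw [X.2, Y.2] at this
  omega

-- The only candidate is `X ⊔ Y`, and the dimension formula decides whether it has the right
-- dimension.
open Classical in
theorem card_common_over [Finite F] [FiniteDimensional F V] {m : ℕ}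
    {X Y : SubspaceOfDim F V (m + 1)} (hXY : X ≠ Y) :
    Nat.card {W : SubspaceOfDim F V (m + 2) // X.1 ≤ W.1 ∧ Y.1 ≤ W.1} =
      if finrank F (X.1 ⊓ Y.1 : Submodule F V) = m then 1 else 0 := by
  simp only [← finrank_sup_eq_add_two_iff]
  have key : ∀ W : SubspaceOfDim F V (m + 2), X.1 ≤ W.1 ∧ Y.1 ≤ W.1 → W.1 = X.1 ⊔ Y.1 := by
    rintro W ⟨h1, h2⟩
    have hlt : X.1 < X.1 ⊔ Y.1 := lt_of_le_of_ne le_sup_left fun h => hXY <| by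
      have : Y.1 ≤ X.1 := h ▸ le_sup_right
      exact (Subtype.ext (Submodule.eq_of_le_of_finrank_eq this (by rw [X.2, Y.2]))).symm
    have := Submodule.finrank_lt_finrank_of_lt hlt
    refine (Submodule.eq_of_le_of_finrank_le (sup_le h1 h2) ?_).symm
    have h3 := X.2
    have h4 := W.2
    omega
  split_ifs with h
  · rw [Nat.card_eq_one_iff_unique]
    exact ⟨⟨fun a b => Subtype.ext (Subtype.ext ((key _ a.2).trans (key _ b.2).symm))⟩,
      ⟨⟨_, h⟩, le_sup_left, le_sup_right⟩⟩
  · have : IsEmpty {W : SubspaceOfDim F V (m + 2) // X.1 ≤ W.1 ∧ Y.1 ≤ W.1} :=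
      ⟨fun W => h (key _ W.2 ▸ W.1.2)⟩
    exact Nat.card_of_isEmpty

-- The only candidate is `X ⊓ Y`. The criterion is the same as for common covers, which is what
-- makes the off-diagonal entries cancel later.
open Classical in
theorem card_common_under [Finite F] [FiniteDimensional F V] {m : ℕ}
    {X Y : SubspaceOfDim F V (m + 1)} (hXY : X ≠ Y) :
    Nat.card {Z : SubspaceOfDim F V m // Z.1 ≤ X.1 ∧ Z.1 ≤ Y.1} =
      if finrank F (X.1 ⊓ Y.1 : Submodule F V) = m then 1 else 0 := by
  have key : ∀ Z : SubspaceOfDim F V m, Z.1 ≤ X.1 ∧ Z.1 ≤ Y.1 → Z.1 = X.1 ⊓ Y.1 := by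
    rintro Z ⟨h1, h2⟩
    have hlt : X.1 ⊓ Y.1 < X.1 := lt_of_le_of_ne inf_le_left fun h => hXY <| by
      have : X.1 ≤ Y.1 := h ▸ inf_le_right
      exact Subtype.ext (Submodule.eq_of_le_of_finrank_eq this (by rw [X.2, Y.2]))
    have := Submodule.finrank_lt_finrank_of_lt hlt
    refine Submodule.eq_of_le_of_finrank_le (le_inf h1 h2) ?_
    have h3 := X.2
    have h4 := Z.2
    omega
  split_ifs with h
  · rw [Nat.card_eq_one_iff_unique]
    exact ⟨⟨fun a b => Subtype.ext (Subtype.ext ((key _ a.2).trans (key _ b.2).symm))⟩,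
      ⟨⟨_, h⟩, inf_le_left, inf_le_right⟩⟩
  · have : IsEmpty {Z : SubspaceOfDim F V m // Z.1 ≤ X.1 ∧ Z.1 ≤ Y.1} :=
      ⟨fun Z => h (key _ Z.2 ▸ Z.1.2)⟩
    exact Nat.card_of_isEmpty

end Counting

/-! ### Incidence matrices and their commutation relation -/

section Incidence

variable (F V : Type*) [Field F] [AddCommGroup V] [Module F V]

open Classical in
/-- The incidence matrix between the subspaces of dimension `i` and those of dimension `i + 1`. -/
noncomputable def subspaceIncidence (i : ℕ) :
    Matrix (SubspaceOfDim F V i) (SubspaceOfDim F V (i + 1)) ℝ :=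
  Matrix.of fun X W => if X.1 ≤ W.1 then 1 else 0

variable [Finite F] [FiniteDimensional F V]

open Matrix

theorem subspaceIncidence_mul_transpose_apply (i : ℕ) (X Y : SubspaceOfDim F V i) :
    (subspaceIncidence F V i * (subspaceIncidence F V i)ᵀ) X Y =
      Nat.card {W : SubspaceOfDim F V (i + 1) // X.1 ≤ W.1 ∧ Y.1 ≤ W.1} := by
  classical
  simp only [subspaceIncidence, mul_apply, transpose_apply, of_apply, ← ite_and, mul_ite, mul_one,
    mul_zero, Finset.sum_boole, Nat.card_eq_fintype_card, Fintype.card_subtype, and_comm]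

theorem transpose_mul_subspaceIncidence_apply (i : ℕ) (X Y : SubspaceOfDim F V (i + 1)) :
    ((subspaceIncidence F V i)ᵀ * subspaceIncidence F V i) X Y =
      Nat.card {Z : SubspaceOfDim F V i // Z.1 ≤ X.1 ∧ Z.1 ≤ Y.1} := by
  classical
  simp only [subspaceIncidence, mul_apply, transpose_apply, of_apply, ← ite_and, mul_ite, mul_one,
    mul_zero, Finset.sum_boole, Nat.card_eq_fintype_card, Fintype.card_subtype, and_comm]

open Classical in
theorem subspaceIncidence_succ_mul_transpose {q n : ℕ} (hq : Nat.card F = q)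
    (hn : finrank F V = n) (i : ℕ) :
    subspaceIncidence F V (i + 1) * (subspaceIncidence F V (i + 1))ᵀ =
      (subspaceIncidence F V i)ᵀ * subspaceIncidence F V i +
        scalar _ (∑ l ∈ Finset.range (n - (i + 1)), (q : ℝ) ^ l -
          ∑ l ∈ Finset.range (i + 1), (q : ℝ) ^ l) := by
  subst hq
  ext X Y
  rw [Matrix.add_apply, subspaceIncidence_mul_transpose_apply,
    transpose_mul_subspaceIncidence_apply, scalar_apply, diagonal_apply]
  split_ifs with h
  · subst h
    simp only [and_self, card_subspaceOfDim_le, card_le_subspaceOfDim hn]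
    push_cast
    ring
  · rw [card_common_over h, card_common_under h, add_zero]

open Classical in
theorem subspaceIncidence_zero_mul_transpose {q n : ℕ} (hq : Nat.card F = q)
    (hn : finrank F V = n) :
    subspaceIncidence F V 0 * (subspaceIncidence F V 0)ᵀ =
        scalar _ (∑ l ∈ Finset.range n, (q : ℝ) ^ l) := by
  subst hq
  ext X Y
  have h : X = Y := Subtype.ext <| by
    rw [Submodule.finrank_eq_zero.1 X.2, Submodule.finrank_eq_zero.1 Y.2]
  subst h
  rw [subspaceIncidence_mul_transpose_apply, scalar_apply, diagonal_apply_eq]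
  simp only [and_self, card_le_subspaceOfDim hn]
  simp

theorem card_subspaceOfDim_zero : Fintype.card (SubspaceOfDim F V 0) = 1 := by
  rw [Fintype.card_eq_one_iff]
  exact ⟨⟨⊥, finrank_bot F V⟩, fun X => Subtype.ext (Submodule.finrank_eq_zero.1 X.2)⟩

/-- Double counting of the incident pairs. -/
theorem card_subspaceOfDim_mul {n : ℕ} (hn : finrank F V = n) (i : ℕ) :
    Fintype.card (SubspaceOfDim F V i) * ∑ l ∈ Finset.range (n - i), Nat.card F ^ l =
      Fintype.card (SubspaceOfDim F V (i + 1)) * ∑ l ∈ Finset.range (i + 1), Nat.card F ^ l := by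
  classical
  have h := Finset.sum_card_bipartiteAbove_eq_sum_card_bipartiteBelow
    (s := (Finset.univ : Finset (SubspaceOfDim F V i)))
    (t := (Finset.univ : Finset (SubspaceOfDim F V (i + 1)))) (fun X W => X.1 ≤ W.1)
  have h1 : ∀ X : SubspaceOfDim F V i, (Finset.bipartiteAbove (fun X W => X.1 ≤ W.1)
      (Finset.univ : Finset (SubspaceOfDim F V (i + 1))) X).card =
        ∑ l ∈ Finset.range (n - i), Nat.card F ^ l := fun X => by
    rw [← card_le_subspaceOfDim hn X, Nat.card_eq_fintype_card, Fintype.card_subtype]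
    rfl
  have h2 : ∀ W : SubspaceOfDim F V (i + 1), (Finset.bipartiteBelow (fun X W => X.1 ≤ W.1)
      (Finset.univ : Finset (SubspaceOfDim F V i)) W).card =
        ∑ l ∈ Finset.range (i + 1), Nat.card F ^ l := fun W => by
    rw [← card_subspaceOfDim_le W, Nat.card_eq_fintype_card, Fintype.card_subtype]
    rfl
  simpa only [h1, h2, Finset.sum_const, smul_eq_mul, Finset.card_univ] using h

end Incidence

/-! ### Characteristic polynomials and root multiplicities -/

section Polynomials

open Polynomial Matrix

variable {R : Type*} [CommRing R] {m n : Type*} [Fintype m] [Fintype n] [DecidableEq m]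
  [DecidableEq n]

/-- The characteristic polynomial of the adjacency matrix of a bipartite graph. -/
theorem Matrix.X_pow_mul_charpoly_fromBlocks_zero (A : Matrix m n R) (B : Matrix n m R) :
    X ^ Fintype.card m * (fromBlocks 0 A B 0).charpoly =
      X ^ Fintype.card n * (A * B).charpoly.comp (X ^ 2) := by
  have h1 : (fromBlocks 0 A B 0).charmatrix =
      fromBlocks (scalar m (X : R[X])) (-A.map C) (-B.map C) (scalar n (X : R[X])) := by
    rw [charmatrix_fromBlocks]
    simp [charmatrix]
  -- Block elimination: the right factor has determinant a power of `X` and clears the lower left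
  -- block.
  have h2 : fromBlocks (scalar m (X : R[X])) (-A.map C) (-B.map C) (scalar n (X : R[X])) *
      fromBlocks (scalar m (X : R[X])) 0 (B.map C) 1 =
      fromBlocks (scalar m ((X : R[X]) ^ 2) - (A * B).map C) (-A.map C) 0 (scalar n (X : R[X])) := by
    rw [fromBlocks_multiply]
    congr 1
    · simp [sub_eq_add_neg, pow_two]
    · simp
    · ext1 i j
      rw [Matrix.neg_mul, Matrix.add_apply, Matrix.neg_apply, scalar_apply, scalar_apply,
        mul_diagonal, diagonal_mul, mul_comm, neg_add_cancel, Matrix.zero_apply]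
    · simp
  have h3 : (scalar m ((X : R[X]) ^ 2) - (A * B).map C).det = (A * B).charpoly.comp (X ^ 2) := by
    rw [Matrix.charpoly, ← coe_compRingHom_apply, RingHom.map_det]
    congr 1
    ext i j
    rw [RingHom.mapMatrix_apply, map_apply, charmatrix_apply, coe_compRingHom_apply, sub_comp,
      C_comp, sub_apply, map_apply, scalar_apply, diagonal_apply, diagonal_apply]
    split_ifs <;> simp
  have h4 := congrArg det h2
  rw [det_mul, det_fromBlocks_zero₁₂, det_fromBlocks_zero₂₁, h3, ← h1] at h4
  simpa [Matrix.charpoly, mul_comm] using h4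

theorem Matrix.charpoly_add_scalar (M : Matrix n n R) (c : R) :
    (M + scalar n c).charpoly = M.charpoly.comp (X - C c) := by
  have := M.charpoly_sub_scalar (-c)
  rwa [map_neg, sub_neg_eq_add, C_neg, ← sub_eq_add_neg] at this

theorem Polynomial.rootMultiplicity_prod_X_sub_C_pow {R ι : Type*} [CommRing R] [IsDomain R]
    [DecidableEq R] (s : Finset ι) (a : ι → R) (e : ι → ℕ) (x : R) :
    (∏ i ∈ s, (X - C (a i)) ^ e i).rootMultiplicity x = ∑ i ∈ s, if a i = x then e i else 0 := by
  rw [← count_roots, roots_prod _ _ (Finset.prod_ne_zero_iff.2 fun i _ =>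
    pow_ne_zero _ (X_sub_C_ne_zero _)), Multiset.count_bind]
  refine Finset.sum_congr rfl fun i _ => ?_
  simp [Multiset.count_singleton, eq_comm]

end Polynomials

/-! ### Recursion for Gaussian binomials -/

section GaussBinom

@[simp]
theorem gaussBinom_zero (q : ℝ) (n : ℕ) : gaussBinom q n 0 = 1 :=
  Finset.prod_range_zero _

@[simp]
theorem gaussBinom_neg_one (q : ℝ) (n : ℕ) : gaussBinom q n (-1) = 0 := rfl

theorem gaussBinom_natCast (q : ℝ) (n j : ℕ) :
    gaussBinom q n (j : ℤ) = ∏ i ∈ Finset.range j, (q ^ n - q ^ i) / (q ^ j - q ^ i) := rfl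

/-- This is the recursion that double counting gives for numbers of subspaces, so the two agree by
induction. -/
theorem gaussBinom_succ {q : ℝ} (hq : 1 < q) (n j : ℕ) :
    gaussBinom q n ((j + 1 : ℕ) : ℤ) * (q ^ (j + 1) - 1) =
      gaussBinom q n (j : ℤ) * (q ^ n / q ^ j - 1) := by
  have hq0 : q ≠ 0 := by positivity
  have key : ∀ i, q ^ (j + 1) - q ^ (i + 1) = q * (q ^ j - q ^ i) := fun i => by ring
  have hj : (∏ i ∈ Finset.range j, (q ^ j - q ^ i)) ≠ 0 :=
    Finset.prod_ne_zero_iff.2 fun i hi => (sub_pos.2 (pow_lt_pow_right₀ hq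
      (Finset.mem_range.1 hi))).ne'
  have h1 : q ^ (j + 1) - 1 ≠ 0 := (sub_pos.2 (one_lt_pow₀ hq (by omega))).ne'
  rw [gaussBinom_natCast, gaussBinom_natCast, Finset.prod_div_distrib, Finset.prod_div_distrib,
    Finset.prod_range_succ, Finset.prod_range_succ' (fun i => q ^ (j + 1) - q ^ i)]
  simp only [key, Finset.prod_mul_distrib, Finset.prod_const, Finset.card_range, pow_zero]
  field_simp

end GaussBinom

/-! ### Numbers of subspaces and their growth -/

section Subspaces

variable (F V : Type*) [Field F] [AddCommGroup V] [Module F V] [Finite F] [FiniteDimensional F V]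

theorem card_subspaceOfDim_eq_gaussBinom {q n : ℕ} (hq : Nat.card F = q) (hn : finrank F V = n)
    (i : ℕ) (hi : i ≤ n) : (Fintype.card (SubspaceOfDim F V i) : ℝ) = gaussBinom q n (i : ℤ) := by
  have hq1 : 1 < (q : ℝ) := by
    rw [← hq]
    exact_mod_cast Finite.one_lt_card (α := F)
  induction i with
  | zero => simp [card_subspaceOfDim_zero]
  | succ i ih =>
    have h1 : (q : ℝ) ^ (i + 1) - 1 ≠ 0 := (sub_pos.2 (one_lt_pow₀ hq1 (by omega))).ne'
    have h2 : (q : ℝ) - 1 ≠ 0 := (sub_pos.2 hq1).ne'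
    refine mul_right_cancel₀ h1 ?_
    rw [gaussBinom_succ hq1, ← ih (by omega)]
    have h := congrArg (Nat.cast (R := ℝ)) (card_subspaceOfDim_mul F V hn i)
    push_cast at h
    rw [hq, geom_sum_eq hq1.ne', geom_sum_eq hq1.ne'] at h
    have h3 : (q : ℝ) ^ n / (q : ℝ) ^ i = (q : ℝ) ^ (n - i) := by
      rw [div_eq_iff (by positivity), ← pow_add, Nat.sub_add_cancel (by omega)]
    rw [h3]
    field_simp at h
    linarith

theorem card_subspaceOfDim_pos {n : ℕ} (hn : finrank F V = n) (i : ℕ) (hi : i ≤ n) :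
    0 < Fintype.card (SubspaceOfDim F V i) := by
  induction i with
  | zero => simp [card_subspaceOfDim_zero]
  | succ i ih =>
    have hsum : 0 < ∑ l ∈ Finset.range (n - i), Nat.card F ^ l :=
      Finset.sum_pos (fun _ _ => pow_pos Nat.card_pos _) ⟨0, by simp; omega⟩
    have h := Nat.mul_pos (ih (by omega)) hsum
    rw [card_subspaceOfDim_mul F V hn i] at h
    exact Nat.pos_of_mul_pos_right h

theorem card_subspaceOfDim_lt_succ {n : ℕ} (hn : finrank F V = n) {i : ℕ} (hi : 2 * i + 1 < n) :
    Fintype.card (SubspaceOfDim F V i) < Fintype.card (SubspaceOfDim F V (i + 1)) := by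
  have h := card_subspaceOfDim_mul F V hn i
  have hpos := card_subspaceOfDim_pos F V hn i (by omega)
  have hlt : ∑ l ∈ Finset.range (i + 1), Nat.card F ^ l <
      ∑ l ∈ Finset.range (n - i), Nat.card F ^ l :=
    Finset.sum_lt_sum_of_subset (i := i + 1) (Finset.range_mono (by omega))
      (Finset.mem_range.2 (by omega)) (by simp) (pow_pos Nat.card_pos _) (by simp)
  by_contra! hle
  have := Nat.mul_le_mul_right (∑ l ∈ Finset.range (i + 1), Nat.card F ^ l) hle
  have := Nat.mul_lt_mul_of_pos_left hlt hpos
  omega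

theorem card_subspaceOfDim_eq_succ {n : ℕ} (hn : finrank F V = n) {i : ℕ} (hi : 2 * i + 1 = n) :
    Fintype.card (SubspaceOfDim F V i) = Fintype.card (SubspaceOfDim F V (i + 1)) := by
  have h := card_subspaceOfDim_mul F V hn i
  rw [show n - i = i + 1 by omega] at h
  refine Nat.eq_of_mul_eq_mul_right ?_ h
  exact Finset.sum_pos (fun _ _ => pow_pos Nat.card_pos _) (by simp)

/-- The increase of the number of subspaces from dimension `j - 1` to dimension `j`. -/
noncomputable def subspaceCountIncrement : ℕ → ℕ
  | 0 => 1
  | j + 1 => Fintype.card (SubspaceOfDim F V (j + 1)) - Fintype.card (SubspaceOfDim F V j)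

theorem subspaceCountIncrement_pos {n : ℕ} (hn : finrank F V = n) {j : ℕ} (hj : 2 * j ≤ n) :
    0 < subspaceCountIncrement F V j := by
  cases j with
  | zero => exact one_pos
  | succ j => exact Nat.sub_pos_of_lt (card_subspaceOfDim_lt_succ F V hn (by omega))

theorem subspaceCountIncrement_eq_zero {n : ℕ} (hn : finrank F V = n) {j : ℕ}
    (hj : 2 * j + 1 = n) : subspaceCountIncrement F V (j + 1) = 0 := by
  rw [subspaceCountIncrement, card_subspaceOfDim_eq_succ F V hn hj, Nat.sub_self]

/-- Up to 2j = n + 1 the counts do not decrease, so the truncated subtraction is a true one. The top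
case is needed for the multiplicity of 0. -/
theorem subspaceCountIncrement_eq_gaussBinom {q n : ℕ} (hq : Nat.card F = q)
    (hn : finrank F V = n) {j : ℕ} (hj : 2 * j ≤ n + 1) (hjn : j ≤ n) :
    (subspaceCountIncrement F V j : ℝ) =
      gaussBinom q n (j : ℤ) - gaussBinom q n ((j : ℤ) - 1) := by
  cases j with
  | zero => simp [subspaceCountIncrement]
  | succ j =>
    have hle : Fintype.card (SubspaceOfDim F V j) ≤ Fintype.card (SubspaceOfDim F V (j + 1)) := by
      rcases eq_or_lt_of_le (show 2 * j + 1 ≤ n by omega) with h | h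
      · exact (card_subspaceOfDim_eq_succ F V hn h).le
      · exact (card_subspaceOfDim_lt_succ F V hn h).le
    rw [subspaceCountIncrement, Nat.cast_sub hle,
      card_subspaceOfDim_eq_gaussBinom F V hq hn _ hjn,
      card_subspaceOfDim_eq_gaussBinom F V hq hn _ (by omega)]
    simp

end Subspaces

/-! ### Positivity and distinctness of the eigenvalues -/

section Values

theorem subspaceGraphEigenvalue_radicand_pos {q : ℝ} (hq : 2 ≤ q) {n k j : ℕ} (hk : 2 * k < n)
    (hj : j ≤ k) : 0 < q ^ (n - j + 1) - q ^ (n - k) + q ^ j - q ^ (k + 1) := by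
  have hq1 : 1 ≤ q := by linarith
  have h1 : q ^ (n - k + 1) ≤ q ^ (n - j + 1) := pow_le_pow_right₀ hq1 (by omega)
  have h2 : q ^ (k + 1) ≤ q ^ (n - k) := pow_le_pow_right₀ hq1 (by omega)
  have h3 : 0 < q ^ j := by positivity
  have h4 : 0 < q ^ (n - k) := by positivity
  rw [pow_succ] at h1
  nlinarith

/-- Passing from j to i < j at least doubles q^(n-j+1), which outweighs the loss of at most q^j. -/
theorem subspaceGraphEigenvalue_radicand_lt {q : ℝ} (hq : 2 ≤ q) {n k i j : ℕ} (hk : 2 * k < n)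
    (hij : i < j) (hj : j ≤ k) :
    q ^ (n - j + 1) - q ^ (n - k) + q ^ j - q ^ (k + 1) <
      q ^ (n - i + 1) - q ^ (n - k) + q ^ i - q ^ (k + 1) := by
  have hq1 : 1 ≤ q := by linarith
  have h1 : q ^ (n - j + 1 + 1) ≤ q ^ (n - i + 1) := pow_le_pow_right₀ hq1 (by omega)
  have h2 : q ^ j ≤ q ^ (n - j + 1) := pow_le_pow_right₀ hq1 (by omega)
  have h3 : 0 < q ^ i := by positivity
  have h4 : 0 < q ^ (n - j + 1) := by positivity
  rw [pow_succ] at h1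
  nlinarith

theorem subspaceGraphEigenvalue_pos {q : ℝ} (hq : 2 ≤ q) {n k j : ℕ} (hk : 2 * k < n)
    (hj : j ≤ k) : 0 < subspaceGraphEigenvalue q n k j :=
  mul_pos (one_div_pos.2 (by linarith))
    (Real.sqrt_pos.2 (subspaceGraphEigenvalue_radicand_pos hq hk hj))

theorem subspaceGraphEigenvalue_lt {q : ℝ} (hq : 2 ≤ q) {n k i j : ℕ} (hk : 2 * k < n)
    (hij : i < j) (hj : j ≤ k) :
    subspaceGraphEigenvalue q n k j < subspaceGraphEigenvalue q n k i :=
  mul_lt_mul_of_pos_left (Real.sqrt_lt_sqrt (subspaceGraphEigenvalue_radicand_pos hq hk hj).le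
    (subspaceGraphEigenvalue_radicand_lt hq hk hij hj)) (one_div_pos.2 (by linarith))

theorem subspaceGraphEigenvalue_injOn {q : ℝ} (hq : 2 ≤ q) {n k i j : ℕ} (hk : 2 * k < n)
    (hi : i ≤ k) (hj : j ≤ k)
    (h : subspaceGraphEigenvalue q n k i = subspaceGraphEigenvalue q n k j) : i = j := by
  rcases lt_trichotomy i j with hij | hij | hij
  · exact absurd h (subspaceGraphEigenvalue_lt hq hk hij hj).ne'
  · exact hij
  · exact absurd h (subspaceGraphEigenvalue_lt hq hk hij hi).ne

theorem subspaceGraphEigenvalue_sq {q : ℝ} (hq : 2 ≤ q) {n k j : ℕ} (hk : 2 * k < n)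
    (hj : j ≤ k) : subspaceGraphEigenvalue q n k j ^ 2 =
      (q ^ (n - j + 1) - q ^ (n - k) + q ^ j - q ^ (k + 1)) / (q - 1) ^ 2 := by
  rw [subspaceGraphEigenvalue, mul_pow,
    Real.sq_sqrt (subspaceGraphEigenvalue_radicand_pos hq hk hj).le, one_div_pow, one_div_mul_eq_div]

end Values

/-! ### The characteristic polynomial of the graph -/

section Charpoly

open Polynomial Matrix

variable (F V : Type*) [Field F] [AddCommGroup V] [Module F V] [Finite F] [FiniteDimensional F V]

open Classical in
theorem charpoly_subspaceIncidence_mul_transpose {q n : ℕ} (hq : Nat.card F = q)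
    (hn : finrank F V = n) (k : ℕ) (hk : 2 * k < n) :
    (subspaceIncidence F V k * (subspaceIncidence F V k)ᵀ).charpoly =
      ∏ j ∈ Finset.range (k + 1), (X - C (((q : ℝ) ^ (n - j + 1) - (q : ℝ) ^ (n - k) + (q : ℝ) ^ j -
        (q : ℝ) ^ (k + 1)) / ((q : ℝ) - 1) ^ 2)) ^ subspaceCountIncrement F V j := by
  have hq1 : 1 < (q : ℝ) := by
    rw [← hq]
    exact_mod_cast Finite.one_lt_card (α := F)
  have h2 : (q : ℝ) - 1 ≠ 0 := (sub_pos.2 hq1).ne'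
  induction k with
  | zero =>
    rw [subspaceIncidence_zero_mul_transpose F V hq hn, scalar_apply, charpoly_diagonal,
      Finset.prod_const, Finset.card_univ, card_subspaceOfDim_zero, geom_sum_eq hq1.ne']
    simp only [zero_add, Finset.prod_range_one, subspaceCountIncrement, pow_one, Nat.sub_zero,
      pow_zero]
    congr 2
    field_simp
    ring
  | succ k ih =>
    rw [subspaceIncidence_succ_mul_transpose F V hq hn, charpoly_add_scalar,
      charpoly_mul_comm_of_le _ _ (card_subspaceOfDim_lt_succ F V hn (by omega)).le,
      ih (by omega), Finset.prod_range_succ _ (k + 1), mul_comm, mul_comp, prod_comp,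
      geom_sum_eq hq1.ne', geom_sum_eq hq1.ne']
    -- This removes the truncated subtractions from the exponents.
    obtain ⟨d, rfl⟩ : ∃ d, n = k + 1 + d := ⟨n - (k + 1), by omega⟩
    simp only [pow_comp, sub_comp, X_comp, C_comp, sub_sub, ← C_add]
    congr 1
    · refine Finset.prod_congr rfl fun j hj => ?_
      congr 3
      rw [show k + 1 + d - (k + 1) = d by omega, show k + 1 + d - k = d + 1 by omega]
      field_simp
      ring
    -- The new root: the power of `X` separating N_kᵀ N_k from N_k N_kᵀ, translated by the scalar.
    · rw [show k + 1 + d - (k + 1) = d by omega, subspaceCountIncrement]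
      congr 3
      field_simp
      ring

open Classical in
theorem charpoly_subspaceGraph_eq_fromBlocks (k : ℕ) [DecidableEq (SubspaceVertex F V k)]
    [DecidableRel (subspaceGraph F V k).Adj] :
    ((subspaceGraph F V k).adjMatrix ℝ).charpoly =
      (fromBlocks 0 (subspaceIncidence F V k) (subspaceIncidence F V k)ᵀ 0).charpoly := by
  have hdisj : Disjoint (fun W : Submodule F V => finrank F W = k)
      (fun W => finrank F W = k + 1) := by
    rw [Pi.disjoint_iff]
    intro W
    rw [Prop.disjoint_iff]
    omega
  have hle : ∀ W W' : Submodule F V, finrank F W = finrank F W' → W ≤ W' → W = W' :=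
    fun W W' h h' => Submodule.eq_of_le_of_finrank_eq h' h
  have hgt : ∀ W W' : Submodule F V, finrank F W = k + 1 → finrank F W' = k → ¬ W ≤ W' := by
    intro W W' h h' hWW'
    have := Submodule.finrank_mono hWW'
    omega
  rw [← charpoly_reindex (subtypeOrEquiv _ _ hdisj)]
  congr 1
  ext (X | X) (Y | Y)
  · have : ¬ (X.1 ≠ Y.1 ∧ (X.1 ≤ Y.1 ∨ Y.1 ≤ X.1)) := fun h => h.1 <| h.2.elim
      (hle _ _ (X.2.trans Y.2.symm)) fun h' => (hle _ _ (Y.2.trans X.2.symm) h').symm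
    simpa [subspaceGraph, Subtype.ext_iff] using this
  · have h1 := hgt _ _ Y.2 X.2
    have h2 : X.1 ≠ Y.1 := fun h => h1 h.ge
    simp [subspaceGraph, Subtype.ext_iff, subspaceIncidence, h1, h2]
  · have h1 := hgt _ _ X.2 Y.2
    have h2 : X.1 ≠ Y.1 := fun h => h1 h.le
    simp [subspaceGraph, Subtype.ext_iff, subspaceIncidence, h1, h2]
  · have : ¬ (X.1 ≠ Y.1 ∧ (X.1 ≤ Y.1 ∨ Y.1 ≤ X.1)) := fun h => h.1 <| h.2.elim
      (hle _ _ (X.2.trans Y.2.symm)) fun h' => (hle _ _ (Y.2.trans X.2.symm) h').symm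
    simpa [subspaceGraph, Subtype.ext_iff] using this

theorem charpoly_subspaceGraph {q n k : ℕ} (hq : Nat.card F = q) (hn : finrank F V = n)
    (hk : 2 * k < n) [DecidableEq (SubspaceVertex F V k)]
    [DecidableRel (subspaceGraph F V k).Adj] :
    ((subspaceGraph F V k).adjMatrix ℝ).charpoly =
      X ^ subspaceCountIncrement F V (k + 1) *
        ((∏ j ∈ Finset.range (k + 1),
          (X - C (subspaceGraphEigenvalue q n k j)) ^ subspaceCountIncrement F V j) *
        ∏ j ∈ Finset.range (k + 1),
          (X - C (-subspaceGraphEigenvalue q n k j)) ^ subspaceCountIncrement F V j) := by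
  classical
  have hq2 : 2 ≤ (q : ℝ) := by
    rw [← hq]
    exact_mod_cast Finite.one_lt_card (α := F)
  have hle : Fintype.card (SubspaceOfDim F V k) ≤ Fintype.card (SubspaceOfDim F V (k + 1)) := by
    rcases eq_or_lt_of_le (show 2 * k + 1 ≤ n by omega) with h | h
    · exact (card_subspaceOfDim_eq_succ F V hn h).le
    · exact (card_subspaceOfDim_lt_succ F V hn h).le
  -- The block formula only holds after multiplication by this power, which is cancelled.
  have hX : (X : ℝ[X]) ^ Fintype.card (SubspaceOfDim F V k) ≠ 0 := pow_ne_zero _ X_ne_zero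
  refine mul_left_cancel₀ hX ?_
  rw [charpoly_subspaceGraph_eq_fromBlocks, X_pow_mul_charpoly_fromBlocks_zero,
    charpoly_subspaceIncidence_mul_transpose F V hq hn k hk, ← mul_assoc, ← pow_add,
    subspaceCountIncrement, Nat.add_sub_cancel' hle, prod_comp, ← Finset.prod_mul_distrib]
  congr 1
  refine Finset.prod_congr rfl fun j hj => ?_
  rw [← subspaceGraphEigenvalue_sq hq2 hk (by simpa [Nat.lt_succ_iff] using hj), ← mul_pow]
  simp only [pow_comp, sub_comp, X_comp, C_comp, C_pow, C_neg]
  congr 1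
  ring

theorem graphEigenvalueMultiplicity_eq {α : Type*} [Fintype α] (G : SimpleGraph α)
    [DecidableEq α] [DecidableRel G.Adj] (x : ℝ) :
    graphEigenvalueMultiplicity G x = (G.adjMatrix ℝ).charpoly.rootMultiplicity x := by
  rw [graphEigenvalueMultiplicity]
  congr!

open Classical in
theorem graphEigenvalueMultiplicity_subspaceGraph {q n k : ℕ} (hq : Nat.card F = q)
    (hn : finrank F V = n) (hk : 2 * k < n) (x : ℝ) :
    graphEigenvalueMultiplicity (subspaceGraph F V k) x =
      (if 0 = x then subspaceCountIncrement F V (k + 1) else 0) +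
        ((∑ j ∈ Finset.range (k + 1),
          if subspaceGraphEigenvalue q n k j = x then subspaceCountIncrement F V j else 0) +
        ∑ j ∈ Finset.range (k + 1),
          if -subspaceGraphEigenvalue q n k j = x then subspaceCountIncrement F V j else 0) := by
  -- A one-term product, so that one multiplicity lemma serves all three factors.
  have h0 : (X : ℝ[X]) ^ subspaceCountIncrement F V (k + 1) =
      ∏ _i ∈ {()}, (X - C 0) ^ subspaceCountIncrement F V (k + 1) := by simp
  have hne : ∀ a : ℕ → ℝ, (∏ j ∈ Finset.range (k + 1),
      (X - C (a j)) ^ subspaceCountIncrement F V j) ≠ 0 := fun a =>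
    Finset.prod_ne_zero_iff.2 fun i _ => pow_ne_zero _ (X_sub_C_ne_zero _)
  rw [graphEigenvalueMultiplicity_eq, charpoly_subspaceGraph F V hq hn hk,
    rootMultiplicity_mul (mul_ne_zero (pow_ne_zero _ X_ne_zero) (mul_ne_zero (hne _) (hne _))),
    rootMultiplicity_mul (mul_ne_zero (hne _) (hne _)), h0]
  simp only [rootMultiplicity_prod_X_sub_C_pow, Finset.sum_singleton]

theorem mem_graphEigenvalues_iff {α : Type*} [Fintype α] (G : SimpleGraph α) (x : ℝ) :
    x ∈ graphEigenvalues G ↔ 0 < graphEigenvalueMultiplicity G x := by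
  classical
  rw [graphEigenvalues, graphEigenvalueMultiplicity, mem_spectrum_iff_isRoot_charpoly,
    rootMultiplicity_pos (charpoly_monic _).ne_zero]

end Charpoly

/-! ### Reading off the spectrum -/

theorem theorem2p2 (F V : Type*) [Field F] [Finite F] [AddCommGroup V] [Module F V]
    [FiniteDimensional F V] (q n k : ℕ) (hq : Nat.card F = q) (hn : Module.finrank F V = n)
    (hk : 2 * k < n) :
    -- the eigenvalues
    graphEigenvalues (subspaceGraph F V k) =
        {x : ℝ | (∃ j : ℕ, j ≤ k ∧
            (x = subspaceGraphEigenvalue q n k j ∨ x = -subspaceGraphEigenvalue q n k j)) ∨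
          (x = 0 ∧ n ≠ 2 * k + 1)} ∧
    -- the listed numbers are pairwise distinct
    (∀ j : ℕ, j ≤ k →
      0 < (q : ℝ) ^ (n - j + 1) - (q : ℝ) ^ (n - k) + (q : ℝ) ^ j - (q : ℝ) ^ (k + 1) ∧
      0 < subspaceGraphEigenvalue q n k j) ∧
    (∀ i j : ℕ, i ≤ k → j ≤ k →
      subspaceGraphEigenvalue q n k i = subspaceGraphEigenvalue q n k j → i = j) ∧
    -- multiplicities of the nonzero eigenvalues, separately and for each pair together
    (∀ j : ℕ, j ≤ k →
      (graphEigenvalueMultiplicity (subspaceGraph F V k)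
          (subspaceGraphEigenvalue q n k j) : ℝ) =
        gaussBinom q n (j : ℤ) - gaussBinom q n ((j : ℤ) - 1) ∧
      (graphEigenvalueMultiplicity (subspaceGraph F V k)
          (-subspaceGraphEigenvalue q n k j) : ℝ) =
        gaussBinom q n (j : ℤ) - gaussBinom q n ((j : ℤ) - 1) ∧
      (graphEigenvalueMultiplicity (subspaceGraph F V k) (subspaceGraphEigenvalue q n k j) : ℝ) +
          (graphEigenvalueMultiplicity (subspaceGraph F V k)
            (-subspaceGraphEigenvalue q n k j) : ℝ) =
        2 * (gaussBinom q n (j : ℤ) - gaussBinom q n ((j : ℤ) - 1))) ∧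
    -- multiplicity of the eigenvalue zero
    (graphEigenvalueMultiplicity (subspaceGraph F V k) 0 : ℝ) =
      gaussBinom q n ((k : ℤ) + 1) - gaussBinom q n (k : ℤ) := by
  have hq2 : 2 ≤ (q : ℝ) := by
    rw [← hq]
    exact_mod_cast Finite.one_lt_card (α := F)
  have hpos : ∀ j ≤ k, 0 < subspaceGraphEigenvalue q n k j := fun j hj =>
    subspaceGraphEigenvalue_pos hq2 hk hj
  have hinj : ∀ i j : ℕ, i ≤ k → j ≤ k →
      subspaceGraphEigenvalue q n k i = subspaceGraphEigenvalue q n k j → i = j :=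
    fun i j hi hj => subspaceGraphEigenvalue_injOn hq2 hk hi hj
  have hmult := graphEigenvalueMultiplicity_subspaceGraph F V hq hn hk
  have hinc : ∀ j ≤ k, (subspaceCountIncrement F V j : ℝ) =
      gaussBinom q n (j : ℤ) - gaussBinom q n ((j : ℤ) - 1) := fun j hj =>
    subspaceCountIncrement_eq_gaussBinom F V hq hn (by omega) (by omega)
  have hplus : ∀ j ≤ k, graphEigenvalueMultiplicity (subspaceGraph F V k)
      (subspaceGraphEigenvalue q n k j) = subspaceCountIncrement F V j := by
    intro j hj
    rw [hmult, if_neg (hpos j hj).ne, zero_add, Finset.sum_eq_single_of_mem j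
      (Finset.mem_range.2 (by omega)), if_pos rfl, Finset.sum_eq_zero, add_zero]
    · intro i hi
      have := hpos i (Nat.lt_succ_iff.1 (Finset.mem_range.1 hi))
      have := hpos j hj
      exact if_neg (by linarith)
    · intro i hi hij
      exact if_neg fun h => hij (hinj _ _ (Nat.lt_succ_iff.1 (Finset.mem_range.1 hi)) hj h)
  have hminus : ∀ j ≤ k, graphEigenvalueMultiplicity (subspaceGraph F V k)
      (-subspaceGraphEigenvalue q n k j) = subspaceCountIncrement F V j := by
    intro j hj
    have hj' := hpos j hj
    rw [hmult, if_neg (by linarith), zero_add, Finset.sum_eq_zero, zero_add,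
      Finset.sum_eq_single_of_mem j (Finset.mem_range.2 (by omega)), if_pos rfl]
    · intro i hi hij
      exact if_neg fun h => hij (hinj _ _ (Nat.lt_succ_iff.1 (Finset.mem_range.1 hi)) hj
        (neg_injective h))
    · intro i hi
      have := hpos i (Nat.lt_succ_iff.1 (Finset.mem_range.1 hi))
      exact if_neg (by linarith)
  have hzero : graphEigenvalueMultiplicity (subspaceGraph F V k) 0 =
      subspaceCountIncrement F V (k + 1) := by
    rw [hmult, if_pos rfl, Finset.sum_eq_zero, Finset.sum_eq_zero, add_zero, add_zero]
    · intro i hi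
      have := hpos i (Nat.lt_succ_iff.1 (Finset.mem_range.1 hi))
      exact if_neg (by linarith)
    · intro i hi
      exact if_neg (hpos i (Nat.lt_succ_iff.1 (Finset.mem_range.1 hi))).ne'
  refine ⟨?_, fun j hj => ⟨subspaceGraphEigenvalue_radicand_pos hq2 hk hj, hpos j hj⟩, hinj,
    fun j hj => ?_, ?_⟩
  · ext x
    rw [mem_graphEigenvalues_iff, Set.mem_ofPred_eq]
    constructor
    · intro hx
      by_contra! hne
      refine hx.ne' ?_
      have hj : ∀ i ∈ Finset.range (k + 1), i ≤ k := fun i hi =>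
        Nat.lt_succ_iff.1 (Finset.mem_range.1 hi)
      rw [hmult, Finset.sum_eq_zero fun i hi => if_neg (hne.1 i (hj i hi)).1.symm,
        Finset.sum_eq_zero fun i hi => if_neg (hne.1 i (hj i hi)).2.symm, add_zero, add_zero]
      split_ifs with h
      -- Here x = 0 is excluded from the list, so n = 2k + 1 and the two blocks have equal size.
      · exact subspaceCountIncrement_eq_zero F V hn (hne.2 h.symm).symm
      · rfl
    · rintro (⟨j, hj, rfl | rfl⟩ | ⟨rfl, hne⟩)
      · rw [hplus j hj]
        exact subspaceCountIncrement_pos F V hn (by omega)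
      · rw [hminus j hj]
        exact subspaceCountIncrement_pos F V hn (by omega)
      · rw [hzero]
        exact subspaceCountIncrement_pos F V hn (by omega)
  · rw [hplus j hj, hminus j hj, hinc j hj]
    exact ⟨rfl, rfl, (two_mul _).symm⟩
  · rw [hzero, subspaceCountIncrement_eq_gaussBinom F V hq hn (j := k + 1) (by omega)
      (by omega)]
    simp
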